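/- Let $G=(V,E)$ be a compact topological packing graph: $V$ is a compact Hausdorff space, and every finite clique of $G$ is contained in a clique that is an open subset of $V$. Let $\alpha(G)$ be the independence number of $G$ (which is finite). \emph{Subsets.} For $k\ge 0$ let $\binom{V}{\le k}$ be the collection of subsets of $V$ with at most $k$ elements, where a family is open if and only if its preimage under $(v_1,\dots,v_k)\mapsto\{v_1,\dots,v_k\}$ is open in $V^k$ (so that $\emptyset$ is an isolated point). Let $\mathcal I_k$ be the subspace of independent sets with at most $k$ elements and $\mathcal I_{=r}\subseteq\mathcal I_k$ the set of those with exactly $r$ elements. For a compact Hausdorff space $X$, let $C(X)$ be the space of continuous real functions on $X$, let $M(X)$ be the space of signed Radon measures on $X$ of bounded total variation, let $M(X)_{\ge0}$ be the cone of nonnegative ones, and let $\langle f,\mu\rangle=\int f\,d\mu$. \emph{The $k$-point bound.} Let $k\ge2$. For a continuous function $F\colon\mathcal I_1^2\times\mathcal I_{k-2}\to\mathbb R$ with $F(S,T,Q)=F(T,S,Q)$ put $$(B_kF)(I)=\sum_{Q\subseteq I,\ |Q|\le k-2}\ \ \sum_{\substack{S,T\subseteq I,\ |S|,|T|\le1\\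 Q\cup S\cup T=I}}F(S,T,Q)\qquad(I\in\mathcal I_k).$$ For $\nu\in M(\mathcal I_k)$ let $B_k^*\nu$ be the signed Radon measure on $\mathcal I_1^2\times\mathcal I_{k-2}$, invariant under $(S,T,Q)\mapsto(T,S,Q)$, with $\langle F,B_k^*\nu\rangle=\langle B_kF,\nu\rangle$ for all such $F$. Let $M(\mathcal I_1^2\times\mathcal I_{k-2})_{\succeq0}$ be the cone of the measures $\tau$ on $\mathcal I_1^2\times\mathcal I_{k-2}$ with the same invariance such that $\langle F,\tau\rangle\ge0$ for every such $F$ for which the kernel $(S,T)\mapsto F(S,T,Q)$ is positive semidefinite for each $Q$. Define $$\Delta_k(G)=\sup\bigl\{\nu(\mathcal I_{=1}):\ \nu\in M(\mathcal I_k)_{\ge0},\ \nu(\{\emptyset\})=1,\ B_k^*\nu\in M(\mathcal I_1^2\times\mathcal I_{k-2})_{\succeq0}\bigr\}.$$ \emph{The copositive hierarchy.} For $r\ge0$ and $F\in C(V^2)$ put $$(\mathcal T_rF)(x_1,\dots,x_{r+2})=\frac1{(r+2)!}\sum_{\pi}F(x_{\pi(1)},x_{\pi(2)}),$$ the sum being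 over all permutations $\pi$ of $\{1,\dots,r+2\}$, and let $\mathcal T_r^*$ be the adjoint, $\langle F,\mathcal T_r^*\beta\rangle=\langle\mathcal T_rF,\beta\rangle$. With $D=\{(x,x):x\in V\}$ and $E$ regarded as a symmetric subset of $V^2$, define $$\xi_r(G)=\sup\bigl\{a(V^2):\ a\in M(V^2)_{\ge0}\text{ symmetric},\ \beta\in M(V^{r+2})_{\ge0},\ a(D)=1,\ a|_E=0,\ a=\mathcal T_r^*\beta\bigr\}.$$ \textbf{Theorem.} If $V\neq\emptyset$, then $\Delta_{r+2}(G)\le\xi_r(G)$ for every integer $r\ge1$. Moreover (also for $V=\emptyset$), $\Delta_k(G)=\alpha(G)$ for every integer $k\ge\alpha(G)+2$. -/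

import Mathlib

noncomputable section

open scoped Classical

/-! ### Radon measures and the duality with continuous functions -/

/-- A nonnegative Radon measure on a compact Hausdorff space `X`: a finite regular measure on the
Borel sigma-algebra of `X` (for products, the Borel sigma-algebra of the product topology). -/
structure RadonMeasure (X : Type*) [TopologicalSpace X] where
  /-- The underlying Borel measure. -/
  toMeasure : @MeasureTheory.Measure X (borel X)
  /-- The measure is finite. -/
  finite : @MeasureTheory.IsFiniteMeasure X (borel X) toMeasure
  /-- The measure is regular. -/
  regular : @MeasureTheory.Measure.Regular X (borel X) _ toMeasure

namespace RadonMeasure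

variable {X : Type*} [TopologicalSpace X]

/-- The measure of a set, as a real number. -/
def mass (μ : RadonMeasure X) (A : Set X) : ℝ :=
  (μ.toMeasure A).toReal

/-- The pairing `⟨f, μ⟩ = ∫ f dμ`. -/
def pairing (f : X → ℝ) (μ : RadonMeasure X) : ℝ :=
  @MeasureTheory.integral X ℝ _ _ (borel X) μ.toMeasure f

end RadonMeasure

/-- A signed Radon measure of bounded total variation: a signed Borel measure whose total variation
is a regular measure (it is finite, since signed measures are real-valued). -/
structure SignedRadonMeasure (X : Type*) [TopologicalSpace X] where
  /-- The underlying signed Borel measure. -/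
  toSigned : @MeasureTheory.SignedMeasure X (borel X)
  /-- The total variation is regular. -/
  regular : @MeasureTheory.Measure.Regular X (borel X) _
    (@MeasureTheory.SignedMeasure.totalVariation X (borel X) toSigned)

namespace SignedRadonMeasure

variable {X : Type*} [TopologicalSpace X]

/-- The pairing `⟨f, μ⟩ = ∫ f dμ⁺ - ∫ f dμ⁻`, where `μ = μ⁺ - μ⁻` is the Jordan decomposition. -/
def pairing (f : X → ℝ) (μ : SignedRadonMeasure X) : ℝ :=
  letI : MeasurableSpace X := borel X
  (∫ x, f x ∂μ.toSigned.toJordanDecomposition.posPart)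
    - ∫ x, f x ∂μ.toSigned.toJordanDecomposition.negPart

end SignedRadonMeasure

/-! ### Spaces of subsets -/

/-- The subsets of `V` with at most `k` elements. -/
def SubsetsLE (V : Type*) (k : ℕ) : Type _ := {S : Finset V // S.card ≤ k}

/-- The map sending a tuple `(v₁, …, v_k)` to the set `{v₁, …, v_k}`. -/
def flatten {V : Type*} {k : ℕ} (v : Fin k → V) : SubsetsLE V k :=
  ⟨Finset.univ.image v, Finset.card_image_le.trans (by simp)⟩

/-- A set of subsets is open iff its preimage under `flatten` is open in `V^k`. For `k ≥ 1` the
empty set is not in the range of `flatten`, so this is the disjoint union of the quotient topology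
on the nonempty subsets and the point `∅`; for `k = 0` the space is the single point `∅`. -/
instance {V : Type*} [TopologicalSpace V] (k : ℕ) : TopologicalSpace (SubsetsLE V k) :=
  TopologicalSpace.coinduced flatten inferInstance

/-- A packing graph: every finite clique is contained in an open clique. -/
def IsPackingGraph {V : Type*} [TopologicalSpace V] (G : SimpleGraph V) : Prop :=
  ∀ C : Finset V, G.IsClique (C : Set V) →
    ∃ U : Set V, IsOpen U ∧ G.IsClique U ∧ (C : Set V) ⊆ U

/-- In a compact packing graph the independent sets have bounded cardinality, so that
`G.indepNum` is the maximum cardinality of an independent set. -/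
theorem IsPackingGraph.bddAbove_indep {V : Type*} [TopologicalSpace V] [CompactSpace V]
    {G : SimpleGraph V} (hG : IsPackingGraph G) :
    BddAbove {n | ∃ s : Finset V, G.IsNIndepSet n s} := by
  have h : ∀ x : V, ∃ U : Set V, IsOpen U ∧ G.IsClique U ∧ x ∈ U := by
    intro x
    obtain ⟨U, h1, h2, h3⟩ := hG {x} (by simp)
    exact ⟨U, h1, h2, h3 (by simp)⟩
  choose U hU hc hx using h
  obtain ⟨t, ht⟩ := isCompact_univ.elim_finite_subcover U hU
    (fun x _ => Set.mem_iUnion.2 ⟨x, hx x⟩)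
  have h2 : ∀ y : V, ∃ x ∈ t, y ∈ U x := by
    intro y
    simpa using ht (Set.mem_univ y)
  choose g hg hgU using h2
  refine ⟨t.card, ?_⟩
  rintro n ⟨s, hs⟩
  rw [← hs.card_eq]
  refine Finset.card_le_card_of_injOn g (fun y _ => hg y) ?_
  intro y hy z hz hyz
  by_contra hne
  exact hs.isIndepSet hy hz hne (hc (g y) (hgU y) (hyz ▸ hgU z) hne)

/-- The independent sets of `G` with at most `k` elements, with the relative topology. -/
abbrev Indep {V : Type*} (G : SimpleGraph V) (k : ℕ) : Type _ :=
  {S : SubsetsLE V k // G.IsIndepSet (S.1 : Set V)}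

namespace Indep

variable {V : Type*} {G : SimpleGraph V} {k : ℕ}

/-- The underlying finite set of vertices. -/
def toFinset (I : Indep G k) : Finset V := I.1.1

theorem toFinset_injective : Function.Injective (toFinset : Indep G k → Finset V) :=
  fun _ _ h => Subtype.ext (Subtype.ext h)

/-- The independent sets of cardinality exactly `r`, as a subset of those of cardinality at
most `k`. -/
def ofCard (G : SimpleGraph V) (k r : ℕ) : Set (Indep G k) := {I | I.toFinset.card = r}

end Indep

/-! ### The `k`-point bound -/

section KPoint

variable {V : Type*} (G : SimpleGraph V)

/-- The triples `(S, T, Q)` of independent sets with `|S|, |T| ≤ 1` and `|Q| ≤ m`. -/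
abbrev Triple (m : ℕ) : Type _ := Indep G 1 × Indep G 1 × Indep G m

variable {G}

/-- The exchange `(S, T, Q) ↦ (T, S, Q)`. -/
def Triple.swap {m : ℕ} (p : Triple G m) : Triple G m := (p.2.1, p.1, p.2.2)

/-- The triples `(S, T, Q)` with `Q ∪ S ∪ T = I`. -/
def triplesWithUnion (m : ℕ) (I : Finset V) : Set (Triple G m) :=
  {p | p.2.2.toFinset ∪ p.1.toFinset ∪ p.2.1.toFinset = I}

theorem finite_triplesWithUnion (m : ℕ) (I : Finset V) :
    (triplesWithUnion m I : Set (Triple G m)).Finite := by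
  refine Set.Finite.of_finite_image (f := fun p : Triple G m =>
    (p.1.toFinset, p.2.1.toFinset, p.2.2.toFinset)) ?_ ?_
  · refine (I.powerset ×ˢ I.powerset ×ˢ I.powerset).finite_toSet.subset ?_
    rintro _ ⟨p, hp, rfl⟩
    have hp : p.2.2.toFinset ∪ p.1.toFinset ∪ p.2.1.toFinset = I := hp
    subst hp
    simp only [Finset.coe_product, Set.mem_prod, Finset.mem_coe, Finset.mem_powerset]
    refine ⟨?_, ?_, ?_⟩ <;> intro x hx <;> simp [hx]
  · rintro p - q - h
    simp only [Prod.mk.injEq] at h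
    exact Prod.ext (Indep.toFinset_injective h.1)
      (Prod.ext (Indep.toFinset_injective h.2.1) (Indep.toFinset_injective h.2.2))

/-- The operator `B_k`: `(B_k F)(I)` is the sum of `F(S, T, Q)` over all `Q` with at most `k - 2`
elements and all `S, T ⊆ I` with at most one element such that `Q ∪ S ∪ T = I`. (Such `Q`, `S`,
`T` are subsets of `I`, hence independent.) Meant for `k ≥ 2`. -/
def opB (k : ℕ) (F : Triple G (k - 2) → ℝ) (I : Indep G k) : ℝ :=
  ∑ p ∈ (finite_triplesWithUnion (k - 2) I.toFinset).toFinset, F p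

variable [TopologicalSpace V]

/-- Continuous functions on the triples that are symmetric in the first two arguments. -/
def symFunctions (G : SimpleGraph V) (m : ℕ) : Set C(Triple G m, ℝ) :=
  {F | ∀ p, F p.swap = F p}

/-- The cone of symmetric continuous `F` such that `(S, T) ↦ F(S, T, Q)` is a positive-semidefinite
kernel for every `Q`. -/
def psdFunctions (G : SimpleGraph V) (m : ℕ) : Set C(Triple G m, ℝ) :=
  {F | F ∈ symFunctions G m ∧ ∀ (Q : Indep G m) (U : Finset (Indep G 1)) (c : Indep G 1 → ℝ),
    0 ≤ ∑ S ∈ U, ∑ T ∈ U, c S * c T * F (S, T, Q)}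

/-- The signed Radon measures on the triples that are invariant under exchanging the first two
arguments. -/
def symMeasures (G : SimpleGraph V) (m : ℕ) : Set (SignedRadonMeasure (Triple G m)) :=
  {τ | ∀ A : Set (Triple G m), @MeasurableSet _ (borel _) A →
    τ.toSigned (Triple.swap ⁻¹' A) = τ.toSigned A}

/-- The dual of the cone `psdFunctions`. -/
def psdMeasures (G : SimpleGraph V) (m : ℕ) : Set (SignedRadonMeasure (Triple G m)) :=
  {τ | τ ∈ symMeasures G m ∧ ∀ F ∈ psdFunctions G m, 0 ≤ τ.pairing F}

/-- `τ = B_k^* ν`: the symmetric signed Radon measure `τ` satisfies `⟨F, τ⟩ = ⟨B_k F, ν⟩` for all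
symmetric continuous `F`. -/
def IsAdjointB (k : ℕ) (ν : RadonMeasure (Indep G k))
    (τ : SignedRadonMeasure (Triple G (k - 2))) : Prop :=
  τ ∈ symMeasures G (k - 2) ∧ ∀ F ∈ symFunctions G (k - 2), τ.pairing F = ν.pairing (opB k F)

/-- Feasibility of `ν` for the `k`-point bound: `ν` is a nonnegative Radon measure, `ν({∅}) = 1`,
and `B_k^* ν` lies in the dual of the cone of positive-semidefinite functions. -/
def IsKPointFeasible (k : ℕ) (ν : RadonMeasure (Indep G k)) : Prop :=
  ν.mass (Indep.ofCard G k 0) = 1 ∧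
    ∃ τ : SignedRadonMeasure (Triple G (k - 2)), IsAdjointB k ν τ ∧ τ ∈ psdMeasures G (k - 2)

/-- The `k`-point bound (for `k ≥ 2`), as a supremum in the extended reals. -/
def kPointBound (G : SimpleGraph V) (k : ℕ) : EReal :=
  sSup {x : EReal | ∃ ν : RadonMeasure (Indep G k), IsKPointFeasible k ν ∧
    x = ((ν.mass (Indep.ofCard G k 1) : ℝ) : EReal)}

end KPoint

/-! ### The primal of the copositive hierarchy -/

section Copositive

variable {V : Type*} [TopologicalSpace V]

/-- The operator `T_r`, which symmetrizes `(x₁, …, x_{r+2}) ↦ F(x₁, x₂)` over all permutations of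
the `r + 2` variables. -/
def opT (r : ℕ) (F : C(V × V, ℝ)) : C(Fin (r + 2) → V, ℝ) where
  toFun x := (1 / ((r + 2).factorial : ℝ)) *
    ∑ π : Equiv.Perm (Fin (r + 2)), F (x (π 0), x (π 1))
  continuous_toFun := by fun_prop

/-- Feasibility of `(a, b)` for the primal problem: `a` is a symmetric nonnegative Radon measure
on `V²` and `b` a nonnegative Radon measure on `V^{r+2}` such that `a` has mass one on the diagonal,
vanishes on the edge set, and equals `T_r^* b`. -/
def IsXiFeasible (G : SimpleGraph V) (r : ℕ) (a : RadonMeasure (V × V))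
    (b : RadonMeasure (Fin (r + 2) → V)) : Prop :=
  (∀ A : Set (V × V), @MeasurableSet _ (borel _) A →
    a.toMeasure (Prod.swap ⁻¹' A) = a.toMeasure A) ∧
  a.mass (Set.diagonal V) = 1 ∧
  @MeasureTheory.Measure.restrict _ (borel _) a.toMeasure {p | G.Adj p.1 p.2} = 0 ∧
  ∀ F : C(V × V, ℝ), a.pairing F = b.pairing (opT r F)

/-- The optimal value `ξ_r(G)`: the supremum of the total mass of `a`, in the extended reals. -/
def xiBound (G : SimpleGraph V) (r : ℕ) : EReal :=
  sSup {x : EReal | ∃ (a : RadonMeasure (V × V)) (b : RadonMeasure (Fin (r + 2) → V)),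
    IsXiFeasible G r a b ∧ x = ((a.mass Set.univ : ℝ) : EReal)}

end Copositive

end

noncomputable section

open scoped Classical

open MeasureTheory Filter Topology

/-! ### Radon measures -/

namespace RadonMeasure

variable {X : Type*} [TopologicalSpace X]

/-! Both claims follow from testing positivity of `B_k^* ν` on kernels that see only cardinalities:
`F(S,T,Q) = h(|Q|) u(|S|) u(|T|)` with `h ≥ 0` vanishing above `k - 2`. Write `⟨g⟩` for the integral
of `g(|I|)` against `ν` and `D` for `surjStep`. Counting triples (`opB_of_card`) turns `B_k F` into
`u(0)² h + 2 u(0) u(1) D h + u(1)² D² h`. Nonnegativity for all `u` is a discriminant condition, `⟨D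
h⟩² ≤ ⟨h⟩ ⟨D² h⟩` (`IsKPointFeasible.sq_cardIntegral_le`).

Exactness: put `N_q = ν(I_{=q})`. Taking `h` to be the indicator of `q` gives `(q+1) N_{q+1}² ≤ N_q
(N_{q+1} + (q+2) N_{q+2})`. Descending from `N_{α+1} = 0` yields `(q+1) N_{q+1} ≤ (α-q) N_q`, and `q
= 0` reads `N_1 ≤ α`. The value `α` is attained by unit point masses at all subsets of a maximum
independent set.

Comparison: take `h = surjCount j` and `s_j = ⟨surjCount j⟩`. The inequality says that `s` is
log-convex; as `s_0 = 1`, it gives `s_{r+2} ≥ s_1 s_{r+1}`. Integrate over `ν` the point masses at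
all `(r+2)`-tuples with entry set `I`, and divide by `s_{r+1}`: this is `β`, and its marginal on two
coordinates is `a`. The diagonal has mass `s_{r+1}/s_{r+1} = 1`, and the total mass is
`s_{r+2}/s_{r+1} ≥ s_1 = ν(I_{=1})`. The packing condition makes coincidences locally constant on
independent tuples, so all integrands are continuous. -/

theorem integrable_of_bounded (μ : RadonMeasure X) {f : X → ℝ} (hf : Continuous f)
    {C : ℝ} (hC : ∀ x, |f x| ≤ C) : @Integrable ℝ _ _ X (borel X) f μ.toMeasure := by
  let _ : MeasurableSpace X := borel X
  have : BorelSpace X := ⟨rfl⟩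
  have := μ.finite
  exact Integrable.of_bound hf.measurable.aestronglyMeasurable C
    (Filter.Eventually.of_forall fun x => by simpa using hC x)

theorem integrable_continuousMap [CompactSpace X] (μ : RadonMeasure X) (f : C(X, ℝ)) :
    @Integrable ℝ _ _ X (borel X) f μ.toMeasure :=
  μ.integrable_of_bounded f.continuous (fun x => by simpa using f.norm_coe_le_norm x)

theorem pairing_one (μ : RadonMeasure X) : pairing (fun _ => 1) μ = μ.mass Set.univ := by
  let _ : MeasurableSpace X := borel X
  simp [pairing, mass, measureReal_def]

theorem pairing_indicator (μ : RadonMeasure X) {A : Set X} (hA : @MeasurableSet X (borel X) A) :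
    pairing (A.indicator fun _ => 1) μ = μ.mass A := by
  let _ : MeasurableSpace X := borel X
  exact integral_indicator_one (μ := μ.toMeasure) hA

theorem mass_nonneg (μ : RadonMeasure X) (A : Set X) : 0 ≤ μ.mass A := ENNReal.toReal_nonneg

/-- The Riesz representation theorem on a compact Hausdorff space. -/
theorem exists_pairing_eq [CompactSpace X] [T2Space X] (L : C(X, ℝ) →ₗ[ℝ] ℝ)
    (hL : ∀ f : C(X, ℝ), (∀ x, 0 ≤ f x) → 0 ≤ L f) :
    ∃ μ : RadonMeasure X, ∀ f : C(X, ℝ), pairing f μ = L f := by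
  let _ : MeasurableSpace X := borel X
  have : BorelSpace X := ⟨rfl⟩
  let M : CompactlySupportedContinuousMap X ℝ →ₗ[ℝ] ℝ :=
    { toFun := fun f => L f.toContinuousMap
      map_add' := fun f g => L.map_add f.toContinuousMap g.toContinuousMap
      map_smul' := fun c f => L.map_smul c f.toContinuousMap }
  let Λ : CompactlySupportedContinuousMap X ℝ →ₚ[ℝ] ℝ :=
    PositiveLinearMap.mk₀ M (fun f hf => hL _ fun x => hf x)
  refine ⟨⟨RealRMK.rieszMeasure Λ, inferInstance, inferInstance⟩, fun f => ?_⟩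
  exact RealRMK.integral_rieszMeasure Λ (CompactlySupportedContinuousMap.continuousMapEquiv f)

/-- A homeomorphism preserving the pairing with continuous functions preserves the measure. -/
theorem measure_preimage_of_pairing_comp [CompactSpace X] [T2Space X] (μ : RadonMeasure X)
    (e : X ≃ₜ X) (h : ∀ f : C(X, ℝ), pairing (fun x => f (e x)) μ = pairing f μ)
    {A : Set X} (hA : @MeasurableSet X (borel X) A) :
    μ.toMeasure (e ⁻¹' A) = μ.toMeasure A := by
  let _ : MeasurableSpace X := borel X
  have : BorelSpace X := ⟨rfl⟩
  have := μ.finite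
  have := μ.regular
  have : (μ.toMeasure.map e).Regular := Measure.Regular.map e
  have : μ.toMeasure.map e = μ.toMeasure := by
    refine Measure.ext_of_integral_eq_on_compactlySupported fun f => ?_
    rw [integral_map e.continuous.measurable.aemeasurable
      (f := f) f.continuous.measurable.aestronglyMeasurable]
    exact h f.toContinuousMap
  conv_rhs => rw [← this]
  rw [Measure.map_apply e.continuous.measurable hA]

/-- An open set on which all continuous functions supported there integrate to zero is null. -/
theorem measure_eq_zero_of_pairing [CompactSpace X] [T2Space X] (μ : RadonMeasure X)
    {U : Set X} (hU : IsOpen U)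
    (h : ∀ f : C(X, ℝ), (∀ x ∉ U, f x = 0) → pairing f μ = 0) : μ.toMeasure U = 0 := by
  let _ : MeasurableSpace X := borel X
  have : BorelSpace X := ⟨rfl⟩
  have := μ.finite
  have := μ.regular
  rw [hU.measure_eq_iSup_isCompact]
  simp only [ENNReal.iSup_eq_zero]
  intro K hKU hK
  -- A Urysohn function supported in `U` dominates the indicator of `K`, so its vanishing integral
  -- forces `K` to be null.
  obtain ⟨f, hf0, hf1, hf⟩ := exists_continuous_zero_one_of_isClosed hU.isClosed_compl hK.isClosed
    (Set.disjoint_left.2 fun x hx hxK => hx (hKU hxK))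
  have h0 := h f (fun x hx => hf0 hx)
  have h1 : μ.toMeasure.real K ≤ 0 := by
    rw [← h0, ← integral_indicator_one hK.measurableSet]
    refine integral_mono ?_ (μ.integrable_continuousMap f) fun x => ?_
    · exact (integrable_const (1 : ℝ)).indicator hK.measurableSet
    · by_cases hx : x ∈ K
      · simp [hx, hf1 hx]
      · simpa [hx] using (hf x).1
  have h2 : μ.toMeasure.real K = 0 := le_antisymm h1 measureReal_nonneg
  exact (measureReal_eq_zero_iff (measure_ne_top _ _)).1 h2

/-- The sum of the Dirac measures at finitely many points. -/
def diracSum [T1Space X] (P : Finset X) : RadonMeasure X :=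
  letI : MeasurableSpace X := borel X
  haveI : BorelSpace X := ⟨rfl⟩
  { toMeasure := ∑ x ∈ P, Measure.dirac x
    finite := inferInstance
    regular := by
      have hval : ∀ A : Set X, MeasurableSet A → (∑ x ∈ P, Measure.dirac x) A =
          ∑ x ∈ P, A.indicator 1 x := by
        intro A hA
        simp [Measure.finsetSum_apply, Measure.dirac_apply' _ hA]
      have h1 : (∑ x ∈ P, Measure.dirac x).OuterRegular := by
        constructor
        intro A hA r hr
        -- Removing from the space the finitely many atoms outside `A` leaves an open superset of
        -- `A` of the same mass; dually, the atoms inside an open set form a compact set carrying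
        -- its mass.
        refine ⟨((P.filter (· ∉ A) : Finset X) : Set X)ᶜ, fun x hx => by simp [hx],
          (P.filter (· ∉ A) : Finset X).finite_toSet.isClosed.isOpen_compl, ?_⟩
        refine lt_of_eq_of_lt ?_ hr
        rw [hval _ hA, hval _
          (P.filter (· ∉ A) : Finset X).finite_toSet.isClosed.isOpen_compl.measurableSet]
        refine Finset.sum_congr rfl fun x hx => ?_
        by_cases hxA : x ∈ A <;> simp [hxA, hx]
      refine { h1 with innerRegular := ?_, toIsFiniteMeasureOnCompacts := inferInstance }
      intro U hU r hr
      refine ⟨(P.filter (· ∈ U) : Finset X), fun x hx => by simp at hx; exact hx.2,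
        (P.filter (· ∈ U) : Finset X).finite_toSet.isCompact, lt_of_lt_of_eq hr ?_⟩
      rw [hval _ hU.measurableSet, hval _
        (P.filter (· ∈ U) : Finset X).finite_toSet.isClosed.measurableSet]
      refine Finset.sum_congr rfl fun x hx => ?_
      by_cases hxA : x ∈ U <;> simp [hxA, hx] }

theorem pairing_diracSum [T1Space X] (P : Finset X) (f : X → ℝ) :
    pairing f (diracSum P) = ∑ x ∈ P, f x := by
  let _ : MeasurableSpace X := borel X
  have : BorelSpace X := ⟨rfl⟩
  change ∫ x, f x ∂(∑ x ∈ P, Measure.dirac x) = _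
  rw [integral_finsetSum_measure fun i _ => integrable_dirac (by simp)]
  simp

theorem diracSum_apply [T1Space X] (P : Finset X) {A : Set X}
    (hA : @MeasurableSet X (borel X) A) :
    (diracSum P).toMeasure A = ∑ x ∈ P, A.indicator 1 x := by
  let _ : MeasurableSpace X := borel X
  change (∑ x ∈ P, Measure.dirac x) A = _
  simp [Measure.finsetSum_apply, Measure.dirac_apply' _ hA]

/-- A nonnegative Radon measure as a signed one. -/
def toSignedRadon (μ : RadonMeasure X) : SignedRadonMeasure X :=
  letI : MeasurableSpace X := borel X
  haveI := μ.finite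
  { toSigned := μ.toMeasure.toSignedMeasure
    regular := by
      have h : SignedMeasure.toJordanDecomposition μ.toMeasure.toSignedMeasure =
          ⟨μ.toMeasure, 0, Measure.MutuallySingular.zero_right⟩ :=
        SignedMeasure.toJordanDecomposition_eq (by simp [JordanDecomposition.toSignedMeasure])
      rw [SignedMeasure.totalVariation, h]
      simpa using μ.regular }

theorem toSignedRadon_apply (μ : RadonMeasure X) {A : Set X}
    (hA : @MeasurableSet X (borel X) A) : μ.toSignedRadon.toSigned A = μ.mass A := by
  let _ : MeasurableSpace X := borel X
  have := μ.finite
  change μ.toMeasure.toSignedMeasure A = _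
  rw [Measure.toSignedMeasure_apply_measurable hA]
  rfl

theorem pairing_toSignedRadon (μ : RadonMeasure X) (f : X → ℝ) :
    μ.toSignedRadon.pairing f = μ.pairing f := by
  let _ : MeasurableSpace X := borel X
  have := μ.finite
  have h : SignedMeasure.toJordanDecomposition μ.toMeasure.toSignedMeasure =
      ⟨μ.toMeasure, 0, Measure.MutuallySingular.zero_right⟩ :=
    SignedMeasure.toJordanDecomposition_eq (by simp [JordanDecomposition.toSignedMeasure])
  change (∫ x, f x ∂(SignedMeasure.toJordanDecomposition μ.toMeasure.toSignedMeasure).posPart) -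
    ∫ x, f x ∂(SignedMeasure.toJordanDecomposition μ.toMeasure.toSignedMeasure).negPart = _
  rw [h]
  simp [pairing]

end RadonMeasure

/-! ### Tuples and the space of independent sets -/

section Tuples

variable {V : Type*}

/-- The tuples in `V^j` whose set of entries is `I`. -/
def surjTuples (j : ℕ) (I : Finset V) : Finset (Fin j → V) :=
  {x ∈ Fintype.piFinset fun _ => I | Finset.univ.image x = I}

theorem mem_surjTuples {j : ℕ} {I : Finset V} {x : Fin j → V} :
    x ∈ surjTuples j I ↔ Finset.univ.image x = I := by
  simp only [surjTuples, Finset.mem_filter, Fintype.mem_piFinset, and_iff_right_iff_imp]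
  rintro rfl i
  simp

/-- The tuples in `V^k` whose entries form an independent set. -/
def indepTuples (G : SimpleGraph V) (k : ℕ) : Set (Fin k → V) :=
  {x | G.IsIndepSet (Set.range x)}

theorem mem_indepTuples {G : SimpleGraph V} {k : ℕ} {x : Fin k → V} :
    x ∈ indepTuples G k ↔ ∀ i j, ¬ G.Adj (x i) (x j) := by
  constructor
  · intro h i j hij
    exact h ⟨i, rfl⟩ ⟨j, rfl⟩ hij.ne hij
  · rintro h _ ⟨i, rfl⟩ _ ⟨j, rfl⟩ -
    exact h i j

/-- The independent set of entries of a tuple. -/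
def Indep.ofTuple {G : SimpleGraph V} {k : ℕ} (x : indepTuples G k) : Indep G k :=
  ⟨flatten x.1, by
    have : G.IsIndepSet (Set.range x.1) := x.2
    simpa [flatten] using this⟩

theorem Indep.toFinset_ofTuple {G : SimpleGraph V} {k : ℕ} (x : indepTuples G k) :
    (Indep.ofTuple x).toFinset = Finset.univ.image x.1 := rfl

theorem card_image_eq_of_pattern {k : ℕ} {x y : Fin k → V}
    (h : ∀ i j, x i = x j ↔ y i = y j) :
    (Finset.univ.image x).card = (Finset.univ.image y).card := by
  have hx : ∀ z : Fin k → V, (Finset.univ.image z).card = Nat.card (Quotient (Setoid.ker z)) := by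
    intro z
    rw [Nat.card_congr (Setoid.quotientKerEquivRange z), Nat.card_coe_set_eq,
      ← Set.ncard_coe_finset]
    simp
  have hk : Setoid.ker x = Setoid.ker y := by
    ext i j
    exact h i j
  rw [hx, hx, hk]

/-- The reciprocal of the number of ways to write `w ∘ φ` in this form, or zero if `w ∘ φ` misses
an entry of `w`. -/
def tupleWeight {k : ℕ} (w : Fin k → V) (φ : Fin k → Fin k) : ℝ :=
  if Finset.univ.image (w ∘ φ) = Finset.univ.image w then
    ((Finset.univ.filter fun ψ : Fin k → Fin k => w ∘ ψ = w ∘ φ).card : ℝ)⁻¹ else 0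

theorem tupleWeight_eq_of_pattern {k : ℕ} {x y : Fin k → V}
    (h : ∀ i j, x i = x j ↔ y i = y j) (φ : Fin k → Fin k) :
    tupleWeight x φ = tupleWeight y φ := by
  have h1 : Finset.univ.image (x ∘ φ) = Finset.univ.image x ↔
      Finset.univ.image (y ∘ φ) = Finset.univ.image y := by
    have key : ∀ z : Fin k → V, Finset.univ.image (z ∘ φ) = Finset.univ.image z ↔
        ∀ i, ∃ j, z (φ j) = z i := by
      intro z
      constructor
      · intro hz i
        have : z i ∈ Finset.univ.image (z ∘ φ) := by rw [hz]; simp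
        simpa using this
      · intro hz
        ext v
        simp only [Finset.mem_image, Finset.mem_univ, true_and, Function.comp_apply]
        constructor
        · rintro ⟨i, rfl⟩
          exact ⟨_, rfl⟩
        · rintro ⟨i, rfl⟩
          exact hz i
    rw [key, key]
    simp only [h]
  have h2 : ∀ ψ : Fin k → Fin k, x ∘ ψ = x ∘ φ ↔ y ∘ ψ = y ∘ φ := by
    intro ψ
    simp only [funext_iff, Function.comp_apply, h]
  simp only [tupleWeight, h1, h2]

/-- Indexing by `φ` makes the range of summation independent of `w`; each tuple is hit once for
every `φ` producing it, and the weight divides this out. The weight depends only on which entries of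
`w` coincide, so continuity in `w` can be checked term by term. -/
theorem sum_surjTuples_image {k : ℕ} (w : Fin k → V) (f : (Fin k → V) → ℝ) :
    ∑ x ∈ surjTuples k (Finset.univ.image w), f x = ∑ φ, tupleWeight w φ * f (w ∘ φ) := by
  have h1 : ∑ φ, tupleWeight w φ * f (w ∘ φ) =
      ∑ φ : Fin k → Fin k with Finset.univ.image (w ∘ φ) = Finset.univ.image w,
        ((Finset.univ.filter fun ψ : Fin k → Fin k => w ∘ ψ = w ∘ φ).card : ℝ)⁻¹ * f (w ∘ φ) := by
    rw [Finset.sum_filter]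
    refine Finset.sum_congr rfl fun φ _ => ?_
    unfold tupleWeight
    split_ifs <;> simp
  rw [h1, ← Finset.sum_fiberwise_of_maps_to (g := fun φ : Fin k → Fin k => w ∘ φ)
    (t := surjTuples k (Finset.univ.image w))]
  · refine Finset.sum_congr rfl fun x hx => ?_
    rw [mem_surjTuples] at hx
    have h2 : (Finset.univ.filter fun ψ : Fin k → Fin k => w ∘ ψ = x).Nonempty := by
      have : ∀ i, ∃ j, w j = x i := by
        intro i
        have : x i ∈ Finset.univ.image w := by rw [← hx]; simp
        simpa using this
      choose ψ hψ using this
      exact ⟨ψ, Finset.mem_filter.2 ⟨Finset.mem_univ _, funext hψ⟩⟩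
    have h3 : ((Finset.univ.filter fun ψ : Fin k → Fin k => w ∘ ψ = x).card : ℝ) ≠ 0 := by
      exact_mod_cast h2.card_pos.ne'
    rw [Finset.filter_filter, Finset.sum_congr (g := fun _ =>
      ((Finset.univ.filter fun ψ : Fin k → Fin k => w ∘ ψ = x).card : ℝ)⁻¹ * f x)
      (s₂ := Finset.univ.filter fun ψ : Fin k → Fin k => w ∘ ψ = x)]
    · rw [Finset.sum_const, nsmul_eq_mul, mul_inv_cancel_left₀ h3]
    · ext φ
      simp only [Finset.mem_filter, Finset.mem_univ, true_and, and_iff_right_iff_imp]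
      rintro rfl
      exact hx
    · intro φ hφ
      simp only [Finset.mem_filter, Finset.mem_univ, true_and] at hφ
      rw [hφ]
  · intro φ hφ
    simpa [mem_surjTuples] using hφ

end Tuples

/-! ### Continuity on the space of independent sets -/

section Topology

variable {V : Type*} [TopologicalSpace V] {G : SimpleGraph V}

instance (k : ℕ) [T1Space V] : T1Space (SubsetsLE V k) where
  t1 S := by
    rw [isClosed_coinduced]
    refine Set.Finite.isClosed ((surjTuples k S.1).finite_toSet.subset ?_)
    intro x hx
    have hx : flatten x = S := hx
    rw [Finset.mem_coe, mem_surjTuples, ← hx]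
    rfl

theorem IsPackingGraph.isOpen_adj [T2Space V] (hG : IsPackingGraph G) :
    IsOpen {p : V × V | G.Adj p.1 p.2} := by
  rw [isOpen_iff_mem_nhds]
  rintro ⟨x, y⟩ hxy
  have hxy : G.Adj x y := hxy
  obtain ⟨U, hU, hc, hs⟩ := hG {x, y} (by simp [SimpleGraph.isClique_iff, Set.pairwise_insert,
    hxy, hxy.symm])
  have h1 : U ×ˢ U ∩ (Set.diagonal V)ᶜ ∈ 𝓝 (x, y) :=
    ((hU.prod hU).inter isClosed_diagonal.isOpen_compl).mem_nhds
      ⟨⟨hs (by simp), hs (by simp)⟩, hxy.ne⟩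
  filter_upwards [h1] with p hp
  exact hc hp.1.1 hp.1.2 hp.2

/-- Each point lies in an open clique, so sufficiently close distinct points are adjacent. Hence
entries of an independent tuple that coincide cannot split under a small perturbation within
independent tuples. -/
theorem IsPackingGraph.isOpen_eq_or_adj [T2Space V] (hG : IsPackingGraph G) :
    IsOpen {p : V × V | p.1 = p.2 ∨ G.Adj p.1 p.2} := by
  rw [isOpen_iff_mem_nhds]
  rintro ⟨x, y⟩ (hxy | hxy)
  · obtain rfl : x = y := hxy
    obtain ⟨U, hU, hc, hs⟩ := hG {x} (by simp)
    filter_upwards [(hU.prod hU).mem_nhds (⟨hs (by simp), hs (by simp)⟩ : (x, x) ∈ U ×ˢ U)]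
      with p hp
    by_cases h : p.1 = p.2
    · exact Or.inl h
    · exact Or.inr (hc hp.1 hp.2 h)
  · filter_upwards [hG.isOpen_adj.mem_nhds hxy] with p hp
    exact Or.inr hp

theorem IsPackingGraph.isClosed_indepTuples [T2Space V] (hG : IsPackingGraph G) (k : ℕ) :
    IsClosed (indepTuples G k) := by
  have : indepTuples G k = ⋂ i, ⋂ j, {x : Fin k → V | ¬ G.Adj (x i) (x j)} := by
    ext x
    simp [mem_indepTuples]
  rw [this]
  refine isClosed_iInter fun i => isClosed_iInter fun j => ?_
  have : Continuous fun x : Fin k → V => (x i, x j) := by fun_prop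
  exact hG.isOpen_adj.isClosed_compl.preimage this

/-- Continuity on the space of independent sets may be checked on tuples. -/
theorem Indep.continuous_of_tuples [T2Space V] (hG : IsPackingGraph G) {k : ℕ} {Y : Type*}
    [TopologicalSpace Y] {g : Indep G k → Y}
    (hg : Continuous fun x : indepTuples G k => g (Indep.ofTuple x)) : Continuous g := by
  rw [continuous_iff_isClosed]
  intro C hC
  -- A subspace of a quotient need not carry the quotient topology. Here it does because the
  -- independent tuples are closed in `V^k`, so relatively closed sets of tuples are closed in
  -- `V^k`.
  have h1 : IsClosed (Subtype.val '' (g ⁻¹' C) : Set (SubsetsLE V k)) := by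
    rw [isClosed_coinduced]
    have : flatten ⁻¹' (Subtype.val '' (g ⁻¹' C) : Set (SubsetsLE V k)) =
        Subtype.val '' ((fun x : indepTuples G k => g (Indep.ofTuple x)) ⁻¹' C) := by
      ext x
      constructor
      · rintro ⟨I, hI, hx⟩
        have hx' : x ∈ indepTuples G k := by
          have := I.2
          rw [hx] at this
          simpa [flatten, indepTuples] using this
        refine ⟨⟨x, hx'⟩, ?_, rfl⟩
        have : Indep.ofTuple ⟨x, hx'⟩ = I := Subtype.ext hx.symm
        simpa [this] using hI
      · rintro ⟨y, hy, rfl⟩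
        exact ⟨Indep.ofTuple y, hy, rfl⟩
    rw [this]
    exact (hG.isClosed_indepTuples k).isClosedEmbedding_subtypeVal.isClosedMap _ (hC.preimage hg)
  rw [← Set.preimage_image_eq (g ⁻¹' C) Subtype.val_injective]
  exact h1.preimage continuous_subtype_val

/-- The pattern of coincidences is locally constant on the independent tuples. -/
theorem IsPackingGraph.eventually_pattern [T2Space V] (hG : IsPackingGraph G) {k : ℕ}
    (x : indepTuples G k) :
    ∀ᶠ y in 𝓝 x, ∀ i j, y.1 i = y.1 j ↔ x.1 i = x.1 j := by
  rw [eventually_all]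
  intro i
  rw [eventually_all]
  intro j
  have hc : Continuous fun x : indepTuples G k => (x.1 i, x.1 j) :=
    ((continuous_apply i).comp continuous_subtype_val).prodMk
      ((continuous_apply j).comp continuous_subtype_val)
  by_cases h : x.1 i = x.1 j
  · filter_upwards [hc.continuousAt.preimage_mem_nhds
      (hG.isOpen_eq_or_adj.mem_nhds (Or.inl h))] with y hy
    simp only [h, iff_true]
    exact hy.resolve_right (mem_indepTuples.1 y.2 i j)
  · filter_upwards [hc.continuousAt.preimage_mem_nhds
      (isClosed_diagonal.isOpen_compl.mem_nhds h)] with y hy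
    simp only [h, iff_false]
    exact hy

theorem Indep.continuous_card [T2Space V] (hG : IsPackingGraph G) (k : ℕ) :
    Continuous fun I : Indep G k => I.toFinset.card := by
  refine Indep.continuous_of_tuples hG (continuous_iff_continuousAt.2 fun x => ?_)
  refine (continuousAt_const (y := (Indep.ofTuple x).toFinset.card)).congr ?_
  filter_upwards [hG.eventually_pattern x] with y hy
  exact (card_image_eq_of_pattern hy).symm

theorem Indep.continuous_sum_surjTuples [T2Space V] (hG : IsPackingGraph G) (k : ℕ)
    {f : (Fin k → V) → ℝ} (hf : Continuous f) :
    Continuous fun I : Indep G k => ∑ x ∈ surjTuples k I.toFinset, f x := by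
  refine Indep.continuous_of_tuples hG ?_
  simp only [Indep.toFinset_ofTuple, sum_surjTuples_image]
  refine continuous_finsetSum _ fun φ _ => Continuous.mul ?_ ?_
  · refine continuous_iff_continuousAt.2 fun x => ?_
    refine (continuousAt_const (y := tupleWeight x.1 φ)).congr ?_
    filter_upwards [hG.eventually_pattern x] with y hy
    exact (tupleWeight_eq_of_pattern hy φ).symm
  · refine hf.comp (continuous_pi fun i => ?_)
    exact (continuous_apply (φ i)).comp continuous_subtype_val

theorem Indep.measurableSet_ofCard [T2Space V] (hG : IsPackingGraph G) (k n : ℕ) :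
    @MeasurableSet _ (borel _) (Indep.ofCard G k n) := by
  let _ : MeasurableSpace (Indep G k) := borel _
  have _ : BorelSpace (Indep G k) := ⟨rfl⟩
  exact ((isOpen_discrete {n}).preimage (Indep.continuous_card hG k)).measurableSet

end Topology

/-! ### Counting the triples with a given union -/

/-- The operator `g ↦ (n ↦ n (g(n) + g(n-1)))`, which sends the number of surjections from a
`j`-element set to the number of surjections from a `(j+1)`-element set. -/
def surjStep (g : ℕ → ℝ) (n : ℕ) : ℝ := n * (g n + g (n - 1))

section Counting

variable {V : Type*}

theorem filter_insert_eq {I : Finset V} {x : V} (hx : x ∈ I) :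
    {Q ∈ I.powerset | insert x Q = I} = {I, I.erase x} := by
  ext Q
  simp only [Finset.mem_filter, Finset.mem_powerset, Finset.mem_insert, Finset.mem_singleton]
  constructor
  · rintro ⟨-, h⟩
    by_cases hxQ : x ∈ Q
    · left
      rw [← h, Finset.insert_eq_of_mem hxQ]
    · right
      rw [← h, Finset.erase_insert hxQ]
  · rintro (rfl | rfl)
    · exact ⟨subset_rfl, Finset.insert_eq_of_mem hx⟩
    · exact ⟨Finset.erase_subset _ _, Finset.insert_erase hx⟩

theorem sum_filter_insert {I : Finset V} {x : V} (hx : x ∈ I) (g : Finset V → ℝ) :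
    ∑ Q ∈ I.powerset with insert x Q = I, g Q = g I + g (I.erase x) := by
  rw [filter_insert_eq hx, Finset.sum_pair]
  intro h
  exact Finset.notMem_erase x I (h ▸ hx)

/-- For each of the `|I|` choices of `x`, exactly two sets `Q` qualify: `I` and `I.erase x`. -/
theorem sum_sum_insert (I : Finset V) (g : ℕ → ℝ) :
    ∑ x ∈ I, ∑ Q ∈ I.powerset with insert x Q = I, g Q.card = surjStep g I.card := by
  rw [Finset.sum_congr rfl fun x hx => sum_filter_insert hx (fun Q => g Q.card),
    Finset.sum_congr rfl fun x hx => by rw [Finset.card_erase_of_mem hx]]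
  simp [surjStep, mul_add]

/-- Grouping the sets `Q` by `R = insert x Q` reduces this to two applications of `sum_sum_insert`.
-/
theorem sum_sum_insert_insert (I : Finset V) (g : ℕ → ℝ) :
    ∑ y ∈ I, ∑ x ∈ I, ∑ Q ∈ I.powerset with insert y (insert x Q) = I, g Q.card =
      surjStep (surjStep g) I.card := by
  rw [← sum_sum_insert]
  refine Finset.sum_congr rfl fun y hy => ?_
  have h1 : ∀ x ∈ I, ∑ Q ∈ I.powerset with insert y (insert x Q) = I, g Q.card =
      ∑ R ∈ I.powerset with insert y R = I,
        ∑ Q ∈ I.powerset with insert x Q = R, g Q.card := by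
    intro x hx
    rw [← Finset.sum_fiberwise_of_maps_to (g := fun Q => insert x Q)
      (t := {R ∈ I.powerset | insert y R = I})]
    · refine Finset.sum_congr rfl fun R hR => ?_
      rw [Finset.filter_filter]
      refine Finset.sum_congr ?_ fun _ _ => rfl
      ext Q
      simp only [Finset.mem_filter, Finset.mem_powerset] at hR ⊢
      constructor
      · rintro ⟨h1, -, h2⟩
        exact ⟨h1, h2⟩
      · rintro ⟨h1, rfl⟩
        exact ⟨h1, hR.2, rfl⟩
    · intro Q hQ
      simp only [Finset.mem_filter, Finset.mem_powerset] at hQ ⊢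
      exact ⟨Finset.insert_subset hx hQ.1, hQ.2⟩
  rw [Finset.sum_congr rfl h1, Finset.sum_comm]
  refine Finset.sum_congr rfl fun R hR => ?_
  simp only [Finset.mem_filter, Finset.mem_powerset] at hR
  rw [← sum_sum_insert]
  symm
  -- An `x` in `I` outside `R` contributes nothing, since no `Q` satisfies `insert x Q = R`.
  refine Finset.sum_subset_zero_on_sdiff hR.1 ?_ ?_
  · intro x hx
    simp only [Finset.mem_sdiff] at hx
    refine Finset.sum_eq_zero fun Q hQ => ?_
    simp only [Finset.mem_filter] at hQ
    exact absurd (hQ.2 ▸ Finset.mem_insert_self x Q) hx.2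
  · intro x hx
    refine Finset.sum_congr ?_ fun _ _ => rfl
    ext Q
    simp only [Finset.mem_filter, Finset.mem_powerset]
    constructor
    · rintro ⟨h1, h2⟩
      exact ⟨h1.trans hR.1, h2⟩
    · rintro ⟨h1, rfl⟩
      exact ⟨Finset.subset_insert _ _, rfl⟩

/-- The subsets of `I` with at most one element. -/
def smallSubsets (I : Finset V) : Finset (Finset V) := insert ∅ (I.image fun x => {x})

theorem mem_smallSubsets {I S : Finset V} : S ∈ smallSubsets I ↔ S ⊆ I ∧ S.card ≤ 1 := by
  simp only [smallSubsets, Finset.mem_insert, Finset.mem_image]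
  constructor
  · rintro (rfl | ⟨x, hx, rfl⟩)
    · simp
    · simpa using hx
  · rintro ⟨h1, h2⟩
    rcases Nat.le_one_iff_eq_zero_or_eq_one.1 h2 with h | h
    · exact Or.inl (Finset.card_eq_zero.1 h)
    · obtain ⟨x, rfl⟩ := Finset.card_eq_one.1 h
      exact Or.inr ⟨x, by simpa using h1, rfl⟩

theorem sum_smallSubsets (I : Finset V) (g : Finset V → ℝ) :
    ∑ S ∈ smallSubsets I, g S = g ∅ + ∑ x ∈ I, g {x} := by
  rw [smallSubsets, Finset.sum_insert (by simp), Finset.sum_image (by simp)]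

/-- A subset of an independent set, as an independent set. -/
def Indep.ofSubset {G : SimpleGraph V} {I : Finset V} (hI : G.IsIndepSet (I : Set V)) {k : ℕ}
    (S : Finset V) (hS : S ⊆ I) (hk : S.card ≤ k) : Indep G k :=
  ⟨⟨S, hk⟩, fun _ hx _ hy => hI (hS hx) (hS hy)⟩

theorem sum_triplesWithUnion {G : SimpleGraph V} (m : ℕ) {I : Finset V}
    (hI : G.IsIndepSet (I : Set V)) (F : Finset V → Finset V → Finset V → ℝ) :
    ∑ p ∈ (finite_triplesWithUnion (G := G) m I).toFinset,
      F p.1.toFinset p.2.1.toFinset p.2.2.toFinset =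
    ∑ S ∈ smallSubsets I, ∑ T ∈ smallSubsets I,
      ∑ Q ∈ I.powerset with Q ∪ S ∪ T = I, if Q.card ≤ m then F S T Q else 0 := by
  have h : ∑ S ∈ smallSubsets I, ∑ T ∈ smallSubsets I,
      ∑ Q ∈ I.powerset with Q ∪ S ∪ T = I, (if Q.card ≤ m then F S T Q else 0) =
      ∑ q ∈ (smallSubsets I ×ˢ smallSubsets I ×ˢ I.powerset) with
        q.2.2 ∪ q.1 ∪ q.2.1 = I ∧ q.2.2.card ≤ m, F q.1 q.2.1 q.2.2 := by
    rw [Finset.sum_filter, Finset.sum_product]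
    refine Finset.sum_congr rfl fun S _ => ?_
    rw [Finset.sum_product]
    refine Finset.sum_congr rfl fun T _ => ?_
    rw [Finset.sum_filter]
    refine Finset.sum_congr rfl fun Q _ => ?_
    by_cases h1 : Q ∪ S ∪ T = I <;> simp only [h1, if_true, if_false, true_and, false_and]
  rw [h]
  refine Finset.sum_bij (fun p _ => (p.1.toFinset, p.2.1.toFinset, p.2.2.toFinset)) ?_ ?_ ?_ ?_
  · intro p hp
    have hp : p.2.2.toFinset ∪ p.1.toFinset ∪ p.2.1.toFinset = I :=
      (finite_triplesWithUnion m I).mem_toFinset.1 hp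
    simp only [Finset.mem_filter, Finset.mem_product, mem_smallSubsets, Finset.mem_powerset]
    refine ⟨⟨⟨?_, p.1.1.2⟩, ⟨?_, p.2.1.1.2⟩, ?_⟩, hp, p.2.2.1.2⟩ <;> rw [← hp] <;> intro x hx <;>
      simp [hx]
  · rintro p - q - h
    simp only [Prod.mk.injEq] at h
    exact Prod.ext (Indep.toFinset_injective h.1)
      (Prod.ext (Indep.toFinset_injective h.2.1) (Indep.toFinset_injective h.2.2))
  · rintro ⟨S, T, Q⟩ hq
    simp only [Finset.mem_filter, Finset.mem_product, mem_smallSubsets, Finset.mem_powerset] at hq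
    obtain ⟨⟨⟨hS, hS1⟩, ⟨hT, hT1⟩, hQ⟩, hU, hQm⟩ := hq
    refine ⟨(Indep.ofSubset hI S hS hS1, Indep.ofSubset hI T hT hT1, Indep.ofSubset hI Q hQ hQm),
      ?_, rfl⟩
    exact (finite_triplesWithUnion m I).mem_toFinset.2 hU
  · intro p _
    rfl

/-- `B_k` applied to a product of functions of the cardinalities. -/
theorem opB_of_card {G : SimpleGraph V} {k : ℕ} {h : ℕ → ℝ} (hh : ∀ n, k - 2 < n → h n = 0)
    (u : ℕ → ℝ) (I : Indep G k) :
    opB k (fun p : Triple G (k - 2) =>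
      h p.2.2.toFinset.card * (u p.1.toFinset.card * u p.2.1.toFinset.card)) I =
    u 0 ^ 2 * h I.toFinset.card + 2 * u 0 * u 1 * surjStep h I.toFinset.card +
      u 1 ^ 2 * surjStep (surjStep h) I.toFinset.card := by
  have hI : G.IsIndepSet (I.toFinset : Set V) := I.2
  rw [opB, sum_triplesWithUnion (k - 2) hI
    (fun S T Q => h Q.card * (u S.card * u T.card))]
  generalize I.toFinset = J
  -- Since `h` vanishes above `k - 2`, the size restriction on `Q` can be dropped.
  have h1 : ∀ S T : Finset V, (∑ Q ∈ J.powerset with Q ∪ S ∪ T = J,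
      if Q.card ≤ k - 2 then h Q.card * (u S.card * u T.card) else 0) =
      (u S.card * u T.card) * ∑ Q ∈ J.powerset with Q ∪ S ∪ T = J, h Q.card := by
    intro S T
    rw [Finset.mul_sum]
    refine Finset.sum_congr rfl fun Q _ => ?_
    split_ifs with hQ
    · ring
    · simp [hh _ (not_le.1 hQ)]
  have h2 : ∀ (Q : Finset V) (x : V), Q ∪ {x} = insert x Q := fun Q x => by
    rw [Finset.union_comm, Finset.singleton_union]
  have h3 : ∑ Q ∈ J.powerset with Q = J, h Q.card = h J.card := by
    rw [Finset.sum_filter, Finset.sum_eq_single J] <;> simp +contextual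
  simp only [h1, sum_smallSubsets, Finset.union_empty, h2, Finset.card_empty,
    Finset.card_singleton, h3, ← Finset.mul_sum, Finset.sum_add_distrib, sum_sum_insert]
  rw [Finset.sum_comm, sum_sum_insert_insert]
  ring

end Counting

/-! ### The inequalities for the masses of a feasible measure -/

section Masses

variable {V : Type*} [TopologicalSpace V] [T2Space V] {G : SimpleGraph V}

/-- The integral of `I ↦ g(|I|)`. -/
def cardIntegral {k : ℕ} (ν : RadonMeasure (Indep G k)) (g : ℕ → ℝ) : ℝ :=
  ν.pairing fun I => g I.toFinset.card

theorem cardIntegral_eq (hG : IsPackingGraph G) {k : ℕ} (ν : RadonMeasure (Indep G k))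
    (g : ℕ → ℝ) :
    cardIntegral ν g = ∑ n ∈ Finset.range (k + 1), g n * ν.mass (Indep.ofCard G k n) := by
  let _ : MeasurableSpace (Indep G k) := borel _
  have _ := ν.finite
  have h1 : (fun I : Indep G k => g I.toFinset.card) = fun I =>
      ∑ n ∈ Finset.range (k + 1), g n * (Indep.ofCard G k n).indicator (fun _ => (1 : ℝ)) I := by
    funext I
    rw [Finset.sum_eq_single I.toFinset.card]
    · simp [Indep.ofCard]
    · intro n _ hn
      simp [Indep.ofCard, hn.symm]
    · intro hI
      have : I.toFinset.card ≤ k := I.1.2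
      simp at hI
      omega
  rw [cardIntegral, h1]
  change ∫ I, _ ∂ν.toMeasure = _
  rw [integral_finsetSum]
  · refine Finset.sum_congr rfl fun n _ => ?_
    rw [integral_const_mul]
    congr 1
    exact ν.pairing_indicator (Indep.measurableSet_ofCard hG k n)
  · intro n _
    exact ((integrable_const (1 : ℝ)).indicator (Indep.measurableSet_ofCard hG k n)).const_mul _

/-- A Cauchy–Schwarz inequality: feasibility makes a quadratic polynomial in `c` nonnegative, and
this is its discriminant condition. All information on `ν` used in the upper bounds enters through
it. -/
theorem IsKPointFeasible.sq_cardIntegral_le (hG : IsPackingGraph G) {k : ℕ}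
    {ν : RadonMeasure (Indep G k)} (hν : IsKPointFeasible k ν) {h : ℕ → ℝ} (h0 : ∀ n, 0 ≤ h n)
    (hh : ∀ n, k - 2 < n → h n = 0) :
    cardIntegral ν (surjStep h) ^ 2 ≤
      cardIntegral ν h * cardIntegral ν (surjStep (surjStep h)) := by
  obtain ⟨-, τ, ⟨-, hτ⟩, -, hpsd⟩ := hν
  have key : ∀ c : ℝ, 0 ≤ cardIntegral ν h * (c * c) + (2 * cardIntegral ν (surjStep h)) * c +
      cardIntegral ν (surjStep (surjStep h)) := by
    intro c
    let u : ℕ → ℝ := fun n => if n = 0 then c else 1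
    have hc : ∀ (g : ℕ → ℝ) (m : ℕ), Continuous fun I : Indep G m => g I.toFinset.card :=
      fun g m => (continuous_of_discreteTopology (f := g)).comp (Indep.continuous_card hG m)
    let F : C(Triple G (k - 2), ℝ) :=
      ⟨fun p => h p.2.2.toFinset.card * (u p.1.toFinset.card * u p.2.1.toFinset.card),
        ((hc h _).comp (continuous_snd.comp continuous_snd)).mul
          (((hc u _).comp continuous_fst).mul
            ((hc u _).comp (continuous_fst.comp continuous_snd)))⟩
    have hF : F ∈ symFunctions G (k - 2) := by
      intro p
      change h p.2.2.toFinset.card * (u p.2.1.toFinset.card * u p.1.toFinset.card) =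
        h p.2.2.toFinset.card * (u p.1.toFinset.card * u p.2.1.toFinset.card)
      ring
    have hF' : F ∈ psdFunctions G (k - 2) := by
      refine ⟨hF, fun Q U w => ?_⟩
      -- For fixed `Q` the kernel is a nonnegative multiple of the rank-one kernel `u(|S|) u(|T|)`.
      have : ∑ S ∈ U, ∑ T ∈ U, w S * w T * F (S, T, Q) =
          h Q.toFinset.card * (∑ S ∈ U, w S * u S.toFinset.card) ^ 2 := by
        rw [pow_two, Finset.sum_mul_sum, Finset.mul_sum]
        refine Finset.sum_congr rfl fun S _ => ?_
        rw [Finset.mul_sum]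
        refine Finset.sum_congr rfl fun T _ => ?_
        change w S * w T * (h Q.toFinset.card * (u S.toFinset.card * u T.toFinset.card)) = _
        ring
      rw [this]
      exact mul_nonneg (h0 _) (sq_nonneg _)
    have h1 := hpsd F hF'
    rw [hτ F hF] at h1
    have h2 : ν.pairing (opB k F) = cardIntegral ν (fun n =>
        c ^ 2 * h n + 2 * c * surjStep h n + surjStep (surjStep h) n) := by
      unfold cardIntegral
      congr 1
      funext I
      refine (opB_of_card hh u I).trans ?_
      simp [u]
    rw [h2, cardIntegral_eq hG] at h1
    rw [cardIntegral_eq hG, cardIntegral_eq hG, cardIntegral_eq hG]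
    refine h1.trans_eq ?_
    rw [Finset.sum_mul, Finset.mul_sum, Finset.sum_mul, ← Finset.sum_add_distrib,
      ← Finset.sum_add_distrib]
    refine Finset.sum_congr rfl fun n _ => ?_
    ring
  have := discrim_le_zero key
  rw [discrim] at this
  nlinarith

end Masses

/-! ### The exactness of the `k`-point bound -/

theorem surjStep_single (q n : ℕ) : surjStep (Pi.single q 1) n =
    (if n = q then (q : ℝ) else 0) + if n = q + 1 then (q + 1 : ℝ) else 0 := by
  unfold surjStep
  -- The case `n = 0` is separate because `n - 1` truncates; the factor `n` removes that spurious
  -- term.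
  rcases n with _ | n
  · by_cases hq0 : q = 0
    · simp [hq0]
    · simp [Ne.symm hq0]
  · by_cases h1 : n + 1 = q
    · simp [← h1]
    · by_cases h2 : n = q
      · subst h2
        simp
      · simp [h1, h2]

theorem surjStep_surjStep_single (q n : ℕ) : surjStep (surjStep (Pi.single q 1)) n =
    (if n = q then (q : ℝ) ^ 2 else 0) +
    (if n = q + 1 then ((q + 1) * (2 * q + 1) : ℝ) else 0) +
    if n = q + 2 then ((q + 1) * (q + 2) : ℝ) else 0 := by
  rw [surjStep, surjStep_single, surjStep_single]
  rcases n with _ | n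
  · by_cases hq0 : q = 0
    · simp [hq0]
    · simp [Ne.symm hq0]
  · rcases lt_trichotomy n q with h | h | h
    · by_cases h1 : n + 1 = q
      · subst h1
        have a1 : n ≠ n + 1 + 1 := by omega
        simp [a1]
        ring
      · have a1 : n ≠ q := by omega
        have a2 : n ≠ q + 1 := by omega
        simp [a1, a2, h1]
    · subst h
      simp
      left
      ring
    · by_cases h1 : n = q + 1
      · subst h1
        have a1 : q + 1 + 1 ≠ q := by omega
        simp [a1]
        ring
      · have a1 : n ≠ q := by omega
        have a2 : n + 1 ≠ q := by omega
        simp [a1, a2, h1]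

/-! ### Feasible measures from independent sets -/

section LowerBound

variable {V : Type*} {G : SimpleGraph V}

/-- The independent sets with at most `k` elements that are contained in `J`. -/
def indepIn (G : SimpleGraph V) (k : ℕ) (J : Finset V) : Finset (Indep G k) :=
  (J.powerset.finite_toSet.preimage
    (Indep.toFinset_injective (G := G) (k := k)).injOn).toFinset

theorem mem_indepIn {k : ℕ} {J : Finset V} {I : Indep G k} :
    I ∈ indepIn G k J ↔ I.toFinset ⊆ J := by
  simp [indepIn]

theorem card_filter_indepIn {k : ℕ} {J : Finset V} (hJ : G.IsIndepSet (J : Set V)) {n : ℕ}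
    (hn : n ≤ k) :
    {I ∈ indepIn G k J | I.toFinset.card = n}.card = J.card.choose n := by
  rw [← Finset.card_powersetCard, ← Finset.card_image_of_injective _ Indep.toFinset_injective]
  congr 1
  ext S
  simp only [Finset.mem_image, Finset.mem_filter, mem_indepIn, Finset.mem_powersetCard]
  constructor
  · rintro ⟨I, hI, rfl⟩
    exact hI
  · rintro ⟨h1, h2⟩
    exact ⟨Indep.ofSubset hJ S h1 (h2.trans_le hn), ⟨h1, h2⟩, rfl⟩

/-- Each triple inside `J` has exactly one union, again a subset of `J` and thus of size at most
`k`; the fibres of the union map therefore partition the triples. -/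
theorem sum_indepIn_opB {k : ℕ} {J : Finset V} (hJ : G.IsIndepSet (J : Set V))
    (hk : J.card ≤ k) (F : Triple G (k - 2) → ℝ) :
    ∑ I ∈ indepIn G k J, opB k F I =
      ∑ p ∈ indepIn G 1 J ×ˢ indepIn G 1 J ×ˢ indepIn G (k - 2) J, F p := by
  simp only [opB]
  rw [← Finset.sum_biUnion]
  · refine Finset.sum_congr ?_ fun _ _ => rfl
    ext p
    simp only [Finset.mem_biUnion, mem_indepIn, Set.Finite.mem_toFinset, Finset.mem_product]
    constructor
    · rintro ⟨I, hI, hp⟩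
      have hp : p.2.2.toFinset ∪ p.1.toFinset ∪ p.2.1.toFinset = I.toFinset := hp
      rw [← hp] at hI
      exact ⟨fun x hx => hI (by simp [hx]), fun x hx => hI (by simp [hx]),
        fun x hx => hI (by simp [hx])⟩
    · rintro ⟨h1, h2, h3⟩
      have h := Finset.union_subset (Finset.union_subset h3 h1) h2
      exact ⟨Indep.ofSubset hJ _ h ((Finset.card_le_card h).trans hk), h, rfl⟩
  · intro I _ I' _ hne
    refine Finset.disjoint_left.2 fun p hp hp' => hne (Indep.toFinset_injective ?_)
    have h1 : p.2.2.toFinset ∪ p.1.toFinset ∪ p.2.1.toFinset = I.toFinset :=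
      (finite_triplesWithUnion _ _).mem_toFinset.1 hp
    have h2 : p.2.2.toFinset ∪ p.1.toFinset ∪ p.2.1.toFinset = I'.toFinset :=
      (finite_triplesWithUnion _ _).mem_toFinset.1 hp'
    exact h1.symm.trans h2

variable [TopologicalSpace V] [T2Space V]

theorem exists_feasible_of_isIndepSet (hG : IsPackingGraph G) {k : ℕ} {J : Finset V}
    (hJ : G.IsIndepSet (J : Set V)) (hk : J.card + 2 ≤ k) :
    ∃ ν : RadonMeasure (Indep G k), IsKPointFeasible k ν ∧
      ν.mass (Indep.ofCard G k 1) = J.card := by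
  have hmass : ∀ n, n ≤ k → (RadonMeasure.diracSum (indepIn G k J)).mass (Indep.ofCard G k n) =
      J.card.choose n := by
    intro n hn
    rw [← RadonMeasure.pairing_indicator _ (Indep.measurableSet_ofCard hG k n),
      RadonMeasure.pairing_diracSum, ← card_filter_indepIn hJ hn, Finset.card_filter]
    push_cast
    refine Finset.sum_congr rfl fun I _ => ?_
    simp [Set.indicator_apply, Indep.ofCard]
  have hsym : (RadonMeasure.diracSum (indepIn G 1 J ×ˢ indepIn G 1 J ×ˢ
      indepIn G (k - 2) J)).toSignedRadon ∈ symMeasures G (k - 2) := by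
    intro A hA
    have hc : Continuous (Triple.swap : Triple G (k - 2) → Triple G (k - 2)) :=
      (continuous_fst.comp continuous_snd).prodMk
        (continuous_fst.prodMk (continuous_snd.comp continuous_snd))
    have hA' : @MeasurableSet _ (borel _) (Triple.swap ⁻¹' A) := hc.borel_measurable hA
    rw [RadonMeasure.toSignedRadon_apply _ hA, RadonMeasure.toSignedRadon_apply _ hA',
      ← RadonMeasure.pairing_indicator _ hA, ← RadonMeasure.pairing_indicator _ hA',
      RadonMeasure.pairing_diracSum, RadonMeasure.pairing_diracSum]
    refine Finset.sum_nbij' Triple.swap Triple.swap ?_ ?_ (fun _ _ => rfl) (fun _ _ => rfl)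
      (fun _ _ => rfl) <;>
    · intro p hp
      simp only [Finset.mem_product] at hp ⊢
      exact ⟨hp.2.1, hp.1, hp.2.2⟩
  refine ⟨RadonMeasure.diracSum (indepIn G k J), ⟨?_, _, ⟨hsym, ?_⟩, hsym, ?_⟩, ?_⟩
  · rw [hmass 0 (by omega)]
    simp
  · intro F _
    rw [RadonMeasure.pairing_toSignedRadon, RadonMeasure.pairing_diracSum,
      RadonMeasure.pairing_diracSum, sum_indepIn_opB hJ (by omega)]
  · intro F hF
    rw [RadonMeasure.pairing_toSignedRadon, RadonMeasure.pairing_diracSum, Finset.sum_product]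
    simp only [Finset.sum_product]
    -- With `Q` outermost, each inner sum is the quadratic form of a positive semidefinite kernel at
    -- the all-ones vector.
    rw [Finset.sum_congr rfl fun S _ => Finset.sum_comm, Finset.sum_comm]
    refine Finset.sum_nonneg fun Q _ => ?_
    simpa using hF.2 Q (indepIn G 1 J) fun _ => 1
  · rw [hmass 1 (by omega)]
    simp

end LowerBound

/-! ### The upper bound by the independence number -/

section Exactness

variable {V : Type*} [TopologicalSpace V] [CompactSpace V] {G : SimpleGraph V}

theorem Indep.card_le_indepNum (hG : IsPackingGraph G) {k : ℕ} (I : Indep G k) :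
    I.toFinset.card ≤ G.indepNum :=
  le_csSup hG.bddAbove_indep ⟨I.toFinset, ⟨I.2, rfl⟩⟩

variable [T2Space V]

theorem IsKPointFeasible.mass_le (hG : IsPackingGraph G) {k : ℕ} (hk : G.indepNum + 2 ≤ k)
    {ν : RadonMeasure (Indep G k)} (hν : IsKPointFeasible k ν) :
    ν.mass (Indep.ofCard G k 1) ≤ G.indepNum := by
  set N : ℕ → ℝ := fun n => ν.mass (Indep.ofCard G k n) with hN
  have hN0 : ∀ n, 0 ≤ N n := fun n => ν.mass_nonneg _
  have hNα : ∀ n, G.indepNum < n → N n = 0 := by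
    intro n hn
    have : Indep.ofCard G k n = ∅ := by
      ext I
      have := I.card_le_indepNum hG
      simp only [Indep.ofCard, Set.mem_ofPred_eq, Set.mem_empty_iff_false, iff_false]
      omega
    simp [hN, this, RadonMeasure.mass]
  -- The test function is the indicator of `q`, admissible because `q ≤ k - 2`. After expansion the
  -- `N q ^ 2` terms cancel and a factor `q + 1` divides out.
  have hrec : ∀ q, q < G.indepNum →
      (q + 1) * N (q + 1) ^ 2 ≤ N q * (N (q + 1) + (q + 2) * N (q + 2)) := by
    intro q hq
    have h := hν.sq_cardIntegral_le hG (h := Pi.single q 1) (fun n => by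
      by_cases hn : n = q
      · subst hn
        simp
      · simp [hn]) (fun n hn => by
        have : n ≠ q := by omega
        simp [this])
    have e0 : cardIntegral ν (Pi.single q 1) = N q := by
      rw [cardIntegral_eq hG, Finset.sum_eq_single q]
      · simp [hN]
      · intro n _ hn
        simp [hn]
      · intro hq'
        simp at hq'
        omega
    have e1 : cardIntegral ν (surjStep (Pi.single q 1)) = q * N q + (q + 1) * N (q + 1) := by
      rw [cardIntegral_eq hG]
      simp only [surjStep_single, add_mul, Finset.sum_add_distrib, ite_mul, zero_mul, Finset.sum_ite_eq',
        Finset.mem_range]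
      rw [if_pos (by omega), if_pos (by omega)]
    have e2 : cardIntegral ν (surjStep (surjStep (Pi.single q 1))) =
        q ^ 2 * N q + (q + 1) * (2 * q + 1) * N (q + 1) + (q + 1) * (q + 2) * N (q + 2) := by
      rw [cardIntegral_eq hG]
      simp only [surjStep_surjStep_single, add_mul _ _ (RadonMeasure.mass _ _), Finset.sum_add_distrib, ite_mul,
        zero_mul, Finset.sum_ite_eq', Finset.mem_range]
      rw [if_pos (by omega), if_pos (by omega), if_pos (by omega)]
    rw [e0, e1, e2] at h
    have hpos : (0 : ℝ) < q + 1 := by positivity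
    refine le_of_mul_le_mul_left ?_ hpos
    linarith
  -- Here `i = α - q`, so this descends in `q` from `N (α + 1) = 0`. The bound is sharp for `N q =
  -- α.choose q`, the masses of the extremal measure.
  have hdown : ∀ i, i ≤ G.indepNum → ∀ q, q + i = G.indepNum →
      (q + 1) * N (q + 1) ≤ i * N q := by
    intro i
    induction i with
    | zero =>
      intro _ q hq
      rw [hNα (q + 1) (by omega)]
      simp
    | succ i ih =>
      intro hi q hq
      have h1 := ih (by omega) (q + 1) (by omega)
      have h2 := hrec q (by omega)
      rcases (hN0 (q + 1)).eq_or_lt with h0 | h0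
      · rw [← h0]
        have := hN0 q
        push_cast
        rw [mul_zero]
        positivity
      · push_cast at h1 ⊢
        refine le_of_mul_le_mul_right ?_ h0
        have h3 : N q * (N (q + 1) + (q + 2) * N (q + 2)) ≤
            N q * (N (q + 1) + i * N (q + 1)) := by
          refine mul_le_mul_of_nonneg_left ?_ (hN0 q)
          have e : (q + 1 + 1 : ℝ) = q + 2 := by ring
          rw [e] at h1
          linarith
        calc (q + 1) * N (q + 1) * N (q + 1) = (q + 1) * N (q + 1) ^ 2 := by ring
          _ ≤ _ := h2
          _ ≤ _ := h3
          _ = (i + 1) * N q * N (q + 1) := by ring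
  have := hdown G.indepNum le_rfl 0 (by simp)
  have h1 : N 0 = 1 := hν.1
  rw [h1] at this
  simpa using this

theorem kPointBound_eq_indepNum (hG : IsPackingGraph G) {k : ℕ} (hk : G.indepNum + 2 ≤ k) :
    kPointBound G k = ((G.indepNum : ℝ) : EReal) := by
  refine le_antisymm (sSup_le ?_) ?_
  · rintro _ ⟨ν, hν, rfl⟩
    exact_mod_cast hν.mass_le hG hk
  · obtain ⟨J, hJ⟩ : G.indepNum ∈ {n | ∃ s : Finset V, G.IsNIndepSet n s} :=
      Nat.sSup_mem ⟨0, ∅, by simp [SimpleGraph.isNIndepSet_iff]⟩ hG.bddAbove_indep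
    obtain ⟨ν, hν, hm⟩ := exists_feasible_of_isIndepSet hG hJ.isIndepSet (hJ.card_eq ▸ hk)
    refine le_sSup ⟨ν, hν, ?_⟩
    rw [hm, hJ.card_eq]

end Exactness

/-! ### The comparison with the copositive hierarchy -/

/-- The number of surjections from a `j`-element set to an `n`-element set. -/
def surjCount (j : ℕ) : ℕ → ℝ := surjStep^[j] (Pi.single 0 1)

theorem surjCount_succ (j : ℕ) : surjCount (j + 1) = surjStep (surjCount j) :=
  Function.iterate_succ_apply' _ _ _

theorem surjCount_nonneg (j n : ℕ) : 0 ≤ surjCount j n := by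
  induction j generalizing n with
  | zero =>
    by_cases hn : n = 0
    · simp [surjCount, hn]
    · simp [surjCount, hn]
  | succ j ih =>
    rw [surjCount_succ]
    exact mul_nonneg (Nat.cast_nonneg _) (add_nonneg (ih _) (ih _))

theorem surjCount_eq_zero {j n : ℕ} (h : j < n) : surjCount j n = 0 := by
  induction j generalizing n with
  | zero => simp [surjCount, h.ne']
  | succ j ih => rw [surjCount_succ, surjStep, ih (by omega), ih (by omega)]; simp

/-! ### Tuples with prescribed entry set -/

section SurjTuples

variable {V : Type*}

theorem image_cons {j : ℕ} (a : V) (x : Fin j → V) :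
    Finset.univ.image (Fin.cons a x : Fin (j + 1) → V) = insert a (Finset.univ.image x) := by
  ext v
  simp [Fin.exists_fin_succ, eq_comm]

/-- Splitting off the first entry `a` leaves a tuple whose entry set `Q` satisfies `insert a Q = I`,
which is the recursion of `sum_sum_insert`. -/
theorem card_surjTuples (j : ℕ) (I : Finset V) :
    ((surjTuples j I).card : ℝ) = surjCount j I.card := by
  induction j generalizing I with
  | zero =>
    by_cases hI : I = ∅
    · have : surjTuples 0 I = Finset.univ := by
        refine Finset.eq_univ_iff_forall.2 fun x => ?_
        simp [mem_surjTuples, hI]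
      rw [this, hI]
      simp [surjCount]
    · have : surjTuples 0 I = ∅ := by
        ext x
        simp [mem_surjTuples, Ne.symm hI]
      have h0 : I.card ≠ 0 := by simpa using hI
      simp [this, surjCount, h0]
  | succ j ih =>
    rw [surjCount_succ, ← sum_sum_insert]
    have h1 : (surjTuples (j + 1) I).card =
        (I.sigma fun a => ({Q ∈ I.powerset | insert a Q = I}).sigma fun Q =>
          surjTuples j Q).card := by
      refine Finset.card_bij' (fun x _ => ⟨x 0, Finset.univ.image (Fin.tail x), Fin.tail x⟩)
        (fun y _ => Fin.cons y.1 y.2.2) ?_ ?_ ?_ ?_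
      · intro x hx
        have hx : Finset.univ.image x = I := mem_surjTuples.1 hx
        have h2 : insert (x 0) (Finset.univ.image (Fin.tail x)) = I := by
          rw [← image_cons, Fin.cons_self_tail, hx]
        simp only [Finset.mem_sigma, Finset.mem_filter, Finset.mem_powerset, mem_surjTuples,
          and_true]
        exact ⟨h2 ▸ Finset.mem_insert_self _ _, h2 ▸ Finset.subset_insert _ _, h2⟩
      · rintro ⟨a, Q, y⟩ hy
        simp only [Finset.mem_sigma, Finset.mem_filter, mem_surjTuples] at hy ⊢
        rw [image_cons, hy.2.2, hy.2.1.2]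
      · intro x _
        exact Fin.cons_self_tail x
      · rintro ⟨a, Q, y⟩ hy
        simp only [Finset.mem_sigma, Finset.mem_filter, mem_surjTuples] at hy
        obtain ⟨-, -, rfl⟩ := hy
        simp
    rw [h1, Finset.card_sigma]
    push_cast
    refine Finset.sum_congr rfl fun a _ => ?_
    rw [Finset.card_sigma]
    push_cast
    exact Finset.sum_congr rfl fun Q _ => ih Q

theorem sum_surjTuples_perm {j : ℕ} (I : Finset V) (π : Equiv.Perm (Fin j))
    (f : (Fin j → V) → ℝ) :
    ∑ x ∈ surjTuples j I, f (x ∘ π) = ∑ x ∈ surjTuples j I, f x := by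
  have h : ∀ (σ : Equiv.Perm (Fin j)) (x : Fin j → V),
      Finset.univ.image (x ∘ σ) = Finset.univ.image x := by
    intro σ x
    ext v
    simp only [Finset.mem_image, Finset.mem_univ, true_and, Function.comp_apply]
    exact ⟨fun ⟨i, hi⟩ => ⟨_, hi⟩, fun ⟨i, hi⟩ => ⟨σ.symm i, by simpa using hi⟩⟩
  refine Finset.sum_nbij' (fun x => x ∘ π) (fun x => x ∘ π.symm) ?_ ?_ ?_ ?_ ?_
  · intro x hx
    rw [mem_surjTuples] at hx ⊢
    rw [h, hx]
  · intro x hx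
    rw [mem_surjTuples] at hx ⊢
    rw [h, hx]
  · intro x _
    funext i
    simp
  · intro x _
    funext i
    simp
  · intro x _
    rfl

theorem sum_surjTuples_swap {r : ℕ} (I : Finset V) (F : V × V → ℝ) :
    ∑ x ∈ surjTuples (r + 2) I, F (x 1, x 0) = ∑ x ∈ surjTuples (r + 2) I, F (x 0, x 1) := by
  simpa using sum_surjTuples_perm I (Equiv.swap (0 : Fin (r + 2)) 1) fun x => F (x 0, x 1)

/-- Dropping a repeated first entry does not change the entry set, and duplicating the first entry
inverts this. -/
theorem sum_surjTuples_diagonal {r : ℕ} (I : Finset V) :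
    (∑ x ∈ surjTuples (r + 2) I, if x 0 = x 1 then (1 : ℝ) else 0) =
      surjCount (r + 1) I.card := by
  rw [← card_surjTuples, ← Finset.sum_filter, Finset.sum_const, nsmul_one]
  congr 1
  refine Finset.card_nbij' (fun x => Fin.tail x) (fun y => Fin.cons (y 0) y) ?_ ?_ ?_ ?_
  · intro x hx
    simp only [Finset.coe_filter, Set.mem_ofPred_eq, mem_surjTuples, Finset.mem_coe] at hx ⊢
    rw [← hx.1]
    conv_rhs => rw [← Fin.cons_self_tail x, image_cons]
    rw [Finset.insert_eq_of_mem]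
    rw [hx.2]
    exact Finset.mem_image_of_mem (Fin.tail x) (Finset.mem_univ 0)
  · intro y hy
    simp only [Finset.coe_filter, Set.mem_ofPred_eq, mem_surjTuples, Finset.mem_coe] at hy ⊢
    refine ⟨?_, rfl⟩
    rw [image_cons, Finset.insert_eq_of_mem (Finset.mem_image_of_mem y (Finset.mem_univ 0)), hy]
  · intro x hx
    simp only [Finset.coe_filter, Set.mem_ofPred_eq] at hx
    have : Fin.tail x 0 = x 0 := hx.2.symm
    simp only [this]
    exact Fin.cons_self_tail x
  · intro y _
    rfl

variable [TopologicalSpace V]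

theorem sum_surjTuples_opT {r : ℕ} (I : Finset V) (F : C(V × V, ℝ)) :
    ∑ x ∈ surjTuples (r + 2) I, opT r F x = ∑ x ∈ surjTuples (r + 2) I, F (x 0, x 1) := by
  change ∑ x ∈ surjTuples (r + 2) I, (1 / ((r + 2).factorial : ℝ)) *
    ∑ π : Equiv.Perm (Fin (r + 2)), F (x (π 0), x (π 1)) = _
  have h : ∀ π : Equiv.Perm (Fin (r + 2)), ∑ x ∈ surjTuples (r + 2) I, F (x (π 0), x (π 1)) =
      ∑ x ∈ surjTuples (r + 2) I, F (x 0, x 1) := fun π =>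
    sum_surjTuples_perm I π fun x => F (x 0, x 1)
  rw [← Finset.mul_sum, Finset.sum_comm, Finset.sum_congr rfl fun π _ => h π]
  have : ((r + 2).factorial : ℝ) ≠ 0 := by positivity
  simp [Fintype.card_perm]
  field_simp

end SurjTuples

/-! ### Constructing a feasible pair for the copositive hierarchy -/

section Comparison

variable {V : Type*} [TopologicalSpace V] [T2Space V] {G : SimpleGraph V}

theorem cardIntegral_surjCount_zero (hG : IsPackingGraph G) {k : ℕ}
    (ν : RadonMeasure (Indep G k)) :
    cardIntegral ν (surjCount 0) = ν.mass (Indep.ofCard G k 0) := by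
  rw [cardIntegral_eq hG, Finset.sum_eq_single 0]
  · simp [surjCount]
  · intro n _ hn
    simp [surjCount, hn]
  · simp

theorem cardIntegral_surjCount_one (hG : IsPackingGraph G) {k : ℕ} (hk : 1 ≤ k)
    (ν : RadonMeasure (Indep G k)) :
    cardIntegral ν (surjCount 1) = ν.mass (Indep.ofCard G k 1) := by
  have h : ∀ n, surjCount 1 n = if n = 1 then 1 else 0 := by
    intro n
    rw [surjCount_succ]
    simpa [surjCount] using surjStep_single 0 n
  rw [cardIntegral_eq hG, Finset.sum_eq_single 1]
  · simp [h]
  · intro n _ hn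
    simp [h, hn]
  · intro h1
    simp at h1
    omega

/-- The numbers `s_j = ∫ #{x ∈ V^j : {x₁, …, x_j} = I} dν(I)` grow at least geometrically. -/
theorem IsKPointFeasible.cardIntegral_surjCount (hG : IsPackingGraph G) {r : ℕ}
    {ν : RadonMeasure (Indep G (r + 2))} (hν : IsKPointFeasible (r + 2) ν)
    (h1 : 0 < cardIntegral ν (surjCount 1)) (j : ℕ) (hj : j ≤ r + 1) :
    0 < cardIntegral ν (surjCount j) ∧
      cardIntegral ν (surjCount 1) * cardIntegral ν (surjCount j) ≤
        cardIntegral ν (surjCount (j + 1)) := by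
  induction j with
  | zero =>
    have h0 : cardIntegral ν (surjCount 0) = 1 := by
      rw [cardIntegral_surjCount_zero hG]
      exact hν.1
    rw [h0]
    simp
  | succ j ih =>
    obtain ⟨hp, hle⟩ := ih (by omega)
    have hp' : 0 < cardIntegral ν (surjCount (j + 1)) := lt_of_lt_of_le (mul_pos h1 hp) hle
    refine ⟨hp', ?_⟩
    -- `surjCount j` vanishes above `j ≤ r = k - 2`. The result is log-convexity, so successive
    -- ratios increase from `s_1 / s_0 = s_1`.
    have h := hν.sq_cardIntegral_le hG (surjCount_nonneg j)
      (fun n hn => surjCount_eq_zero (by omega))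
    rw [← surjCount_succ, ← surjCount_succ] at h
    refine le_of_mul_le_mul_left ?_ hp
    calc _ = cardIntegral ν (surjCount 1) * cardIntegral ν (surjCount j) *
          cardIntegral ν (surjCount (j + 1)) := by ring
      _ ≤ cardIntegral ν (surjCount (j + 1)) * cardIntegral ν (surjCount (j + 1)) :=
          mul_le_mul_of_nonneg_right hle hp'.le
      _ = cardIntegral ν (surjCount (j + 1)) ^ 2 := by ring
      _ ≤ _ := h

theorem mass_diagonal_eq (a : RadonMeasure (V × V))
    (ha : a.toMeasure {p | G.Adj p.1 p.2} = 0) {f : C(V × V, ℝ)} (h1 : ∀ x, f (x, x) = 1)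
    (h0 : ∀ x y, x ≠ y → ¬ G.Adj x y → f (x, y) = 0) :
    a.mass (Set.diagonal V) = a.pairing f := by
  let _ : MeasurableSpace (V × V) := borel _
  have _ : BorelSpace (V × V) := ⟨rfl⟩
  rw [← a.pairing_indicator isClosed_diagonal.measurableSet]
  refine integral_congr_ae ?_
  have : ∀ᵐ p ∂a.toMeasure, ¬ G.Adj p.1 p.2 := by
    rw [ae_iff]
    simpa using ha
  filter_upwards [this] with p hp
  by_cases h : p.1 = p.2
  · obtain ⟨x, y⟩ := p
    obtain rfl : x = y := h
    simp [h1]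
  · rw [Set.indicator_of_notMem (by simpa using h)]
    exact (h0 p.1 p.2 h hp).symm

/-- Point masses at a constant tuple are feasible. This covers measures `ν` with no mass on
singletons, for which the normalization by `s_{r+1}` may be unavailable. -/
theorem xiBound_nonneg [Nonempty V] (r : ℕ) : (0 : EReal) ≤ xiBound G r := by
  obtain ⟨v⟩ := ‹Nonempty V›
  let _ : MeasurableSpace (V × V) := borel _
  have _ : BorelSpace (V × V) := ⟨rfl⟩
  let a : RadonMeasure (V × V) := RadonMeasure.diracSum {(v, v)}
  let b : RadonMeasure (Fin (r + 2) → V) := RadonMeasure.diracSum {fun _ => v}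
  refine le_trans ?_ (le_sSup ⟨a, b, ⟨?_, ?_, ?_, ?_⟩, rfl⟩)
  · exact_mod_cast a.mass_nonneg _
  · intro A hA
    have hA' : @MeasurableSet _ (borel _) (Prod.swap ⁻¹' A) := continuous_swap.borel_measurable hA
    rw [RadonMeasure.diracSum_apply _ hA, RadonMeasure.diracSum_apply _ hA',
      Finset.sum_singleton, Finset.sum_singleton]
    rfl
  · rw [← a.pairing_indicator isClosed_diagonal.measurableSet, RadonMeasure.pairing_diracSum]
    simp
  · rw [Measure.restrict_eq_zero]
    refine le_antisymm ?_ zero_le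
    have : a.toMeasure (Set.diagonal V)ᶜ = 0 := by
      rw [RadonMeasure.diracSum_apply _ isClosed_diagonal.isOpen_compl.measurableSet]
      simp
    rw [← this]
    exact measure_mono fun p hp => hp.ne
  · intro F
    rw [RadonMeasure.pairing_diracSum, RadonMeasure.pairing_diracSum]
    have : ((r + 2).factorial : ℝ) ≠ 0 := by positivity
    simp [opT, Fintype.card_perm]
    field_simp

variable [CompactSpace V]

theorem integrable_sum_surjTuples (hG : IsPackingGraph G) {k : ℕ} (ν : RadonMeasure (Indep G k))
    (f : C(Fin k → V, ℝ)) :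
    @Integrable ℝ _ _ _ (borel _) (fun I : Indep G k => ∑ x ∈ surjTuples k I.toFinset, f x)
      ν.toMeasure := by
  refine ν.integrable_of_bounded (Indep.continuous_sum_surjTuples hG k f.continuous)
    (C := (∑ n ∈ Finset.range (k + 1), surjCount k n) * ‖f‖) fun I => ?_
  calc |∑ x ∈ surjTuples k I.toFinset, f x| ≤ ∑ x ∈ surjTuples k I.toFinset, |f x| :=
        Finset.abs_sum_le_sum_abs _ _
    _ ≤ ∑ x ∈ surjTuples k I.toFinset, ‖f‖ :=
        Finset.sum_le_sum fun x _ => by simpa using f.norm_coe_le_norm x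
    _ = surjCount k I.toFinset.card * ‖f‖ := by simp [card_surjTuples]
    _ ≤ _ := by
        refine mul_le_mul_of_nonneg_right ?_ (norm_nonneg _)
        refine Finset.single_le_sum (fun n _ => surjCount_nonneg k n) ?_
        have : I.toFinset.card ≤ k := I.1.2
        simpa [Nat.lt_succ_iff] using this

/-- The functional `f ↦ c ∫ ∑ f(x) dν(I)`, where the sum is over all tuples `x` whose set of entries
is `I`. -/
def tupleFunctional (hG : IsPackingGraph G) {k : ℕ} (ν : RadonMeasure (Indep G k)) (c : ℝ) :
    C(Fin k → V, ℝ) →ₗ[ℝ] ℝ where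
  toFun f := c * ν.pairing fun I => ∑ x ∈ surjTuples k I.toFinset, f x
  map_add' f g := by
    let _ : MeasurableSpace (Indep G k) := borel _
    simp only [RadonMeasure.pairing, ContinuousMap.add_apply, Finset.sum_add_distrib]
    rw [integral_add (integrable_sum_surjTuples hG ν f) (integrable_sum_surjTuples hG ν g), mul_add]
  map_smul' a f := by
    let _ : MeasurableSpace (Indep G k) := borel _
    simp only [RadonMeasure.pairing, ContinuousMap.smul_apply, smul_eq_mul, ← Finset.mul_sum,
      RingHom.id_apply]
    rw [integral_const_mul]
    ring

theorem tupleFunctional_apply (hG : IsPackingGraph G) {k : ℕ} (ν : RadonMeasure (Indep G k))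
    (c : ℝ) (f : C(Fin k → V, ℝ)) : tupleFunctional hG ν c f =
      c * ν.pairing fun I => ∑ x ∈ surjTuples k I.toFinset, f x := rfl

theorem tupleFunctional_nonneg (hG : IsPackingGraph G) {k : ℕ} (ν : RadonMeasure (Indep G k))
    {c : ℝ} (hc : 0 ≤ c) (f : C(Fin k → V, ℝ)) (hf : ∀ x, 0 ≤ f x) :
    0 ≤ tupleFunctional hG ν c f := by
  let _ : MeasurableSpace (Indep G k) := borel _
  exact mul_nonneg hc (integral_nonneg fun I => Finset.sum_nonneg fun x _ => hf x)

/-- The diagonal is closed and the pairs that are equal or adjacent form an open neighbourhood of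
it, so Urysohn's lemma applies. Modulo an edge-null measure, this continuous function replaces the
indicator of the diagonal. -/
theorem IsPackingGraph.exists_diagonal_function (hG : IsPackingGraph G) :
    ∃ f : C(V × V, ℝ), (∀ x, f (x, x) = 1) ∧ ∀ x y, x ≠ y → ¬ G.Adj x y → f (x, y) = 0 := by
  obtain ⟨f, h0, h1, -⟩ := exists_continuous_zero_one_of_isClosed
    hG.isOpen_eq_or_adj.isClosed_compl (isClosed_diagonal (X := V))
    (Set.disjoint_left.2 fun p hp hd => hp (Or.inl hd))
  exact ⟨f, fun x => h1 rfl, fun x y hne hadj => h0 fun h => h.elim hne hadj⟩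

theorem kPointBound_le_xiBound (hG : IsPackingGraph G) [Nonempty V] (r : ℕ) :
    kPointBound G (r + 2) ≤ xiBound G r := by
  refine sSup_le ?_
  rintro _ ⟨ν, hν, rfl⟩
  have e1 := cardIntegral_surjCount_one hG (by omega) ν
  rcases (ν.mass_nonneg (Indep.ofCard G (r + 2) 1)).eq_or_lt with h0 | h0
  · rw [← h0]
    exact xiBound_nonneg r
  rw [← e1] at h0 ⊢
  obtain ⟨hpos, hle⟩ := hν.cardIntegral_surjCount hG h0 (r + 1) le_rfl
  set s := cardIntegral ν (surjCount (r + 1)) with hs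
  have hs0 : 0 ≤ s⁻¹ := (inv_pos.2 hpos).le
  -- Dividing by `s_{r+1}` normalizes the diagonal mass: tuples with `x 0 = x 1` are counted by
  -- `surjCount (r + 1)`.
  let L := tupleFunctional hG ν s⁻¹
  have hL := tupleFunctional_nonneg hG ν hs0
  obtain ⟨b, hb⟩ := RadonMeasure.exists_pairing_eq L hL
  let e : C(Fin (r + 2) → V, V × V) := ⟨fun x => (x 0, x 1), by fun_prop⟩
  -- `a` is the marginal of `b` on the first two coordinates. It equals `T_r^* b` because the tuples
  -- with a given entry set are permutation invariant, so symmetrizing changes no sum.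
  obtain ⟨a, ha⟩ := RadonMeasure.exists_pairing_eq
    (L ∘ₗ (ContinuousMap.compRightAlgHom ℝ ℝ e).toLinearMap)
    (fun f hf => hL _ fun x => hf _)
  replace ha : ∀ F : C(V × V, ℝ), a.pairing F =
      s⁻¹ * ν.pairing fun I => ∑ x ∈ surjTuples (r + 2) I.toFinset, F (x 0, x 1) := ha
  have hindep : ∀ (I : Indep G (r + 2)), ∀ x ∈ surjTuples (r + 2) I.toFinset,
      ¬ G.Adj (x 0) (x 1) := by
    intro I x hx hadj
    rw [mem_surjTuples] at hx
    refine I.2 ?_ ?_ hadj.ne hadj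
    · change x 0 ∈ I.toFinset
      rw [← hx]
      simp
    · change x 1 ∈ I.toFinset
      rw [← hx]
      simp
  have hE : a.toMeasure {p | G.Adj p.1 p.2} = 0 := by
    refine a.measure_eq_zero_of_pairing hG.isOpen_adj fun f hf => ?_
    rw [ha]
    have : ∀ I : Indep G (r + 2),
        ∑ x ∈ surjTuples (r + 2) I.toFinset, f (x 0, x 1) = 0 := fun I =>
      Finset.sum_eq_zero fun x hx => hf _ (hindep I x hx)
    simp [this, RadonMeasure.pairing]
  refine le_trans ?_ (le_sSup ⟨a, b, ⟨?_, ?_, ?_, ?_⟩, rfl⟩)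
  · have h1 : a.mass Set.univ = s⁻¹ * cardIntegral ν (surjCount (r + 2)) := by
      have := ha 1
      rw [← a.pairing_one]
      refine this.trans ?_
      simp [cardIntegral, card_surjTuples]
    rw [h1]
    norm_cast
    rw [inv_mul_eq_div, le_div_iff₀ hpos]
    exact hle
  · intro A hA
    refine a.measure_preimage_of_pairing_comp (Homeomorph.prodComm V V) (fun f => ?_) hA
    have := ha (f.comp ⟨Prod.swap, continuous_swap⟩)
    refine this.trans ?_
    rw [ha]
    simp only [ContinuousMap.comp_apply, ContinuousMap.coe_mk, Prod.swap_prod_mk,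
      sum_surjTuples_swap _ f]
  · obtain ⟨f, h1, h0⟩ := hG.exists_diagonal_function
    rw [mass_diagonal_eq a hE h1 h0, ha]
    have : ∀ I : Indep G (r + 2), ∑ x ∈ surjTuples (r + 2) I.toFinset, f (x 0, x 1) =
        surjCount (r + 1) I.toFinset.card := by
      intro I
      rw [← sum_surjTuples_diagonal]
      refine Finset.sum_congr rfl fun x hx => ?_
      split_ifs with h
      · rw [h, h1]
      · exact h0 _ _ h (hindep I x hx)
    simp only [this]
    change s⁻¹ * s = 1
    exact inv_mul_cancel₀ hpos.ne'
  · let _ : MeasurableSpace (V × V) := borel _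
    rw [Measure.restrict_eq_zero]
    exact hE
  · intro F
    rw [ha, hb]
    change _ = s⁻¹ * _
    simp only [sum_surjTuples_opT]

end Comparison

end

theorem theorem3p4 {V : Type*} [TopologicalSpace V] [T2Space V] [CompactSpace V]
    (G : SimpleGraph V) (hG : IsPackingGraph G) :
    (Nonempty V → ∀ r : ℕ, 1 ≤ r → kPointBound G (r + 2) ≤ xiBound G r) ∧
    (∀ k : ℕ, G.indepNum + 2 ≤ k → kPointBound G k = ((G.indepNum : ℝ) : EReal)) := by
  exact ⟨fun _ r _ => kPointBound_le_xiBound hG r, fun _ hk => kPointBound_eq_indepNum hG hk⟩
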